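/- Let $K$ be an algebraically closed field of characteristic zero and let $R_K\subset\mathbb{R}$ be a $\mathbb{Q}$-linear subspace, ordered as a subset of $\mathbb{R}$. Let $K_P[[x]]$ be the field of formal series $\sum_{\mu}c_\mu x^{\mu}$ with coefficients $c_\mu\in K$ whose set of exponents $\{\mu : c_\mu\neq 0\}$ is a well-ordered subset of $R_K$, with the usual addition and multiplication of series. Let - $K_P^0[[x]]\subset K_P[[x]]$ be the set of series whose set of exponents is finite or is the image of a sequence diverging to $+\infty$; - $K_{\mathbb{Q}}^0[[x]]\subset K_P^0[[x]]$ be the set of those series all of whose exponents are rational; - $K[[x^{1/s}]]:=\bigcup_{s\in\mathbb{N},\,s\ge 1}K[[x^{1/s}]][x^{-1/s}]$ be the set of classical Puiseux series, that is, of the series with rational, well-ordered set of exponents contained in $\frac1s\mathbb{Z}$ for some integer $s\ge 1$ (depending on the series). Then $K_P^0[[x]]$ and $K_{\mathbb{Q}}^0[[x]]$ are subfields of $K_P[[x]]$, the classical Puiseux series form a field, and each of these three fields is algebraically closed. (The last case is the Newton–Puiseux theorem.) -/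

import Mathlib

namespace GenPuiseux

/-- A set of real exponents of level zero: it is finite, or it is the image of a sequence of its
elements that diverges to infinity. -/
def LevelZero (s : Set ℝ) : Prop :=
  s.Finite ∨ ∃ u : ℕ → ℝ, Filter.Tendsto u Filter.atTop Filter.atTop ∧ s = Set.range u

/-- The field `K_P[[x]]` of generalised Puiseux series with exponents in a `ℚ`-linear subspace `R`
of `ℝ` (ordered as a subset of `ℝ`): formal series in `x` with coefficients in `K` whose set of
exponents is a well ordered subset of `R`. -/
abbrev PuiseuxField (R : Submodule ℚ ℝ) (K : Type*) [Field K] : Type _ :=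
  HahnSeries R K

/-- The set of exponents of a generalised Puiseux series, as a set of real numbers. -/
def exponents {R : Submodule ℚ ℝ} {K : Type*} [Field K] (f : PuiseuxField R K) : Set ℝ :=
  (fun r : R => (r : ℝ)) '' f.support

/-- `K_P^0[[x]]`: the generalised Puiseux series whose set of exponents has level zero. -/
def levelZeroSeries (R : Submodule ℚ ℝ) (K : Type*) [Field K] : Set (PuiseuxField R K) :=
  {f | LevelZero (exponents f)}

/-- `K_ℚ^0[[x]]`: the elements of `K_P^0[[x]]` all of whose exponents are rational. -/
def rationalLevelZeroSeries (R : Submodule ℚ ℝ) (K : Type*) [Field K] :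
    Set (PuiseuxField R K) :=
  {f | f ∈ levelZeroSeries R K ∧ exponents f ⊆ Set.range (fun q : ℚ => (q : ℝ))}

/-- The classical Puiseux series `⋃_{s ≥ 1} K[[x^{1/s}]][x^{-1/s}]`: the series with rational
exponents whose exponents all lie in `(1/s)ℤ` for some `s ≥ 1`. The set of exponents of a Hahn
series is well ordered, so it is then bounded below. -/
def classicalPuiseuxSeries (K : Type*) [Field K] : Set (HahnSeries ℚ K) :=
  {f | ∃ s : ℕ, 0 < s ∧ ∀ q ∈ f.support, ∃ n : ℤ, q = (n : ℚ) / (s : ℚ)}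

end GenPuiseux

namespace GenPuiseux

open Polynomial
open scoped Pointwise

/-! ### Hensel lifting, coefficient by coefficient. -/

section

/-! Each of the three sets consists of the Hahn series whose support satisfies a condition `Φ`:
left-finite, left-finite and rational, or of bounded denominator. The axioms `IsSupportFamily` on
`Φ` suffice both for a field and for its algebraic closedness, so the three cases share one proof.

Roots are found by induction on the degree `n` of a monic polynomial. A translation kills the
coefficient of degree `n - 1`, which is possible in characteristic zero. If zero is not a root,
rescaling the roots by a monomial read off the Newton polygon makes all exponents nonnegative, and
the reduction to exponent zero is still depressed but not `X ^ n`. Over `K` it therefore splits into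
two coprime nonconstant factors (`exists_coprime_factorization_of_depressed`). Hensel's lemma
(`exists_factorization_of_isCoprime`) lifts the splitting with all exponents in the additive monoid
generated by the old ones, so the factors stay in the field (`exists_factorization`), and the
induction applies to one of them. -/

theorem exists_mul_add_mul_eq_of_isCoprime {K : Type*} [Field K] {a b r : K[X]} (ha : a.Monic)
    (hab : IsCoprime a b) (hr : r.degree < a.degree + b.degree) :
    ∃ u v : K[X], u * b + a * v = r ∧ u.degree < a.degree ∧ v.degree < b.degree := by
  obtain ⟨s, t, hst⟩ := hab
  have hdiv := modByMonic_add_div (t * r) a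
  have heq : (t * r %ₘ a) * b + a * (r * s + (t * r /ₘ a) * b) = r := by
    linear_combination b * hdiv + r * hst
  have hu : (t * r %ₘ a).degree < a.degree := degree_modByMonic_lt _ ha
  refine ⟨_, _, heq, hu, ?_⟩
  set u := t * r %ₘ a
  set v := r * s + (t * r /ₘ a) * b
  by_contra! hv
  have hb : b.degree ≠ ⊥ := fun h => by simp [h] at hr
  have h1 : (u * b).degree < a.degree + b.degree := by
    rw [degree_mul]
    exact WithBot.add_lt_add_right hb hu
  have h2 : (a * v).degree < a.degree + b.degree := by
    have : a * v = r - u * b := by linear_combination heq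
    rw [this]
    exact (degree_sub_le _ _).trans_lt (max_lt hr h1)
  rw [degree_mul] at h2
  exact absurd h2 (not_lt.2 (by gcongr))

variable {Γ : Type*} [AddCommGroup Γ] [LinearOrder Γ] [IsOrderedAddMonoid Γ]
  {K : Type*} [Field K]

/-- Comparing coefficients at `m ≠ 0` in `G * H = F` gives `G m * b + a * H m = F m - (terms at
smaller exponents)`. Coprimality solves this within the degree bounds, and `M` is well-ordered, so
the recursion is well-founded. -/
theorem exists_factor_coeffs {M : AddSubmonoid Γ} (hM : (M : Set Γ).IsPWO)
    (hpos : ∀ m ∈ M, 0 ≤ m) {a b : K[X]} (ha : a.Monic) (hb : b.Monic) (hab : IsCoprime a b)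
    {F : Γ → K[X]} (hF0 : F 0 = a * b) (hF : ∀ m ≠ 0, (F m).degree < a.degree + b.degree) :
    ∃ G H : Γ → K[X], G 0 = a ∧ H 0 = b ∧ (∀ m ∉ M, G m = 0 ∧ H m = 0) ∧
      (∀ m ≠ 0, (G m).degree < a.degree ∧ (H m).degree < b.degree) ∧
      ∀ m ∈ M, ∑ p ∈ Finset.antidiagonal hM hM m, G p.1 * H p.2 = F m := by
  classical
  have hS : ∀ r : K[X], ∃ p : K[X] × K[X], r.degree < a.degree + b.degree →
      p.1 * b + a * p.2 = r ∧ p.1.degree < a.degree ∧ p.2.degree < b.degree := fun r => by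
    by_cases hr : r.degree < a.degree + b.degree
    · obtain ⟨u, v, h⟩ := exists_mul_add_mul_eq_of_isCoprime ha hab hr
      exact ⟨(u, v), fun _ => h⟩
    · exact ⟨0, fun h => absurd h hr⟩
  choose S hS using hS
  have hP : ((M : Set Γ) \ {0}).IsPWO := hM.mono Set.sdiff_subset
  have wf : WellFounded (fun x y : M => x < y) := hM.isWF
  let step : (m : M) → ((y : M) → y < m → K[X] × K[X]) → K[X] × K[X] := fun m ih =>
    if m = 0 then (a, b) else
      -- The default `0` is never reached: two nonzero elements of `M` with sum `m` both lie in `M`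
      -- below `m`.
      let g : Γ → K[X] × K[X] := fun x =>
        if h : ∃ hx : x ∈ M, (⟨x, hx⟩ : M) < m then ih ⟨x, h.1⟩ h.2 else 0
      S (F m - ∑ p ∈ Finset.antidiagonal hP hP (m : Γ), (g p.1).1 * (g p.2).2)
  let Q : Γ → K[X] × K[X] := fun x => if h : x ∈ M then wf.fix step ⟨x, h⟩ else 0
  have hQ0 : Q 0 = (a, b) := by
    have h : Q 0 = wf.fix step 0 := dif_pos M.zero_mem
    rw [h, wf.fix_eq]
    exact if_pos rfl
  have hlt : ∀ m : Γ, ∀ p ∈ Finset.antidiagonal hP hP m,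
      (p.1 ∈ M ∧ p.1 < m ∧ p.1 ≠ 0) ∧ (p.2 ∈ M ∧ p.2 < m ∧ p.2 ≠ 0) := by
    intro m p hp
    obtain ⟨⟨h1, h1'⟩, ⟨h2, h2'⟩, rfl⟩ := Finset.mem_antidiagonal.1 hp
    have h3 := lt_of_le_of_ne (hpos _ h1) (Ne.symm h1')
    have h4 := lt_of_le_of_ne (hpos _ h2) (Ne.symm h2')
    exact ⟨⟨h1, lt_add_of_pos_right _ h4, h1'⟩, ⟨h2, lt_add_of_pos_left _ h3, h2'⟩⟩
  have hQ : ∀ m ∈ M, m ≠ 0 → Q m =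
      S (F m - ∑ p ∈ Finset.antidiagonal hP hP m, (Q p.1).1 * (Q p.2).2) := by
    intro m hm hm0
    have hm0' : (⟨m, hm⟩ : M) ≠ 0 := fun h => hm0 (congrArg Subtype.val h)
    have h : Q m = wf.fix step ⟨m, hm⟩ := dif_pos hm
    rw [h, wf.fix_eq]
    refine (if_neg hm0').trans ?_
    refine congrArg S (congrArg (F m - ·) (Finset.sum_congr rfl fun p hp => ?_))
    obtain ⟨⟨h1, h1', -⟩, ⟨h2, h2', -⟩⟩ := hlt m p hp
    have e1 : Q p.1 = wf.fix step ⟨p.1, h1⟩ := dif_pos h1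
    have e2 : Q p.2 = wf.fix step ⟨p.2, h2⟩ := dif_pos h2
    rw [e1, e2]
    congr 2
    · exact dif_pos (c := ∃ hx : p.1 ∈ M, (⟨p.1, hx⟩ : M) < ⟨m, hm⟩) ⟨h1, h1'⟩
    · exact dif_pos (c := ∃ hx : p.2 ∈ M, (⟨p.2, hx⟩ : M) < ⟨m, hm⟩) ⟨h2, h2'⟩
  have hQn : ∀ m ∉ M, Q m = 0 := fun m hm => by simp only [Q, hm, dif_neg, not_false_iff]
  have ha0 : a.degree ≠ ⊥ := by simpa [degree_eq_bot] using ha.ne_zero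
  have hb0 : b.degree ≠ ⊥ := by simpa [degree_eq_bot] using hb.ne_zero
  have hrem : ∀ m ≠ 0, (∀ x < m, x ∈ M → x ≠ 0 →
        (Q x).1.degree < a.degree ∧ (Q x).2.degree < b.degree) →
      (F m - ∑ p ∈ Finset.antidiagonal hP hP m, (Q p.1).1 * (Q p.2).2).degree
        < a.degree + b.degree := by
    intro m hm0 ih
    refine (degree_sub_le _ _).trans_lt (max_lt (hF m hm0) ?_)
    refine (degree_sum_le _ _).trans_lt ((Finset.sup_lt_iff ?_).2 fun p hp => ?_)
    · exact bot_lt_iff_ne_bot.2 (by simp [WithBot.add_eq_bot, ha0, hb0])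
    · obtain ⟨⟨h1, h1', h1''⟩, ⟨h2, h2', h2''⟩⟩ := hlt m p hp
      have h3 := (ih _ h1' h1 h1'').1
      have h4 := (ih _ h2' h2 h2'').2
      rw [degree_mul]
      exact (add_le_add_left h3.le _).trans_lt (WithBot.add_lt_add_left ha0 h4)
  have hdeg : ∀ m : M, (m : Γ) ≠ 0 →
      (Q m).1.degree < a.degree ∧ (Q m).2.degree < b.degree := by
    intro m
    induction m using wf.induction with
    | _ m ih =>
      intro hm0
      rw [hQ m m.2 hm0]
      exact (hS _ (hrem m hm0 fun x hx hxM hx0 => ih ⟨x, hxM⟩ hx hx0)).2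
  refine ⟨fun m => (Q m).1, fun m => (Q m).2, by simp [hQ0], by simp [hQ0],
    fun m hm => by simp [hQn m hm], fun m hm0 => ?_, fun m hm => ?_⟩
  · by_cases hm : m ∈ M
    · exact hdeg ⟨m, hm⟩ hm0
    · simp only [hQn m hm]
      simpa [bot_lt_iff_ne_bot] using ⟨ha.ne_zero, hb.ne_zero⟩
  · by_cases hm0 : m = 0
    · subst hm0
      have : Finset.antidiagonal hM hM (0 : Γ) = {(0, 0)} := by
        ext ⟨x, y⟩
        simp only [Finset.mem_antidiagonal, Finset.mem_singleton, Prod.mk.injEq]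
        constructor
        · rintro ⟨hx, hy, h⟩
          exact (add_eq_zero_iff_of_nonneg (hpos _ hx) (hpos _ hy)).1 h
        · rintro ⟨rfl, rfl⟩
          exact ⟨M.zero_mem, M.zero_mem, add_zero _⟩
      simp [this, hQ0, hF0]
    · have key := (hS _ (hrem m hm0 fun x _ hxM hx0 => hdeg ⟨x, hxM⟩ hx0)).1
      rw [← hQ m hm hm0] at key
      -- The pairs `(m, 0)` and `(0, m)` give the linear part `G m * b + a * H m`; the others form
      -- the right-hand side of the recursion.
      have : Finset.antidiagonal hM hM m =
          insert (m, 0) (insert (0, m) (Finset.antidiagonal hP hP m)) := by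
        ext ⟨x, y⟩
        simp only [Finset.mem_antidiagonal, Finset.mem_insert, Prod.mk.injEq, Set.mem_sdiff,
          Set.mem_singleton_iff, SetLike.mem_coe]
        constructor
        · rintro ⟨hx, hy, rfl⟩
          by_cases hx0 : x = 0
          · simp [hx0]
          · by_cases hy0 : y = 0
            · simp [hy0]
            · exact Or.inr (Or.inr ⟨⟨hx, hx0⟩, ⟨hy, hy0⟩, rfl⟩)
        · rintro (⟨rfl, rfl⟩ | ⟨rfl, rfl⟩ | ⟨⟨hx, -⟩, ⟨hy, -⟩, rfl⟩)
          · exact ⟨hm, M.zero_mem, add_zero _⟩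
          · exact ⟨M.zero_mem, hm, zero_add _⟩
          · exact ⟨hx, hy, rfl⟩
      rw [this, Finset.sum_insert, Finset.sum_insert]
      · simp only [hQ0]
        linear_combination key
      · simp [Finset.mem_antidiagonal]
      · simp [Finset.mem_antidiagonal, hm0]

end

/-! ### Hensel's lemma over Hahn series; fields defined by support conditions. -/

section

variable {Γ : Type*} [AddCommGroup Γ] [LinearOrder Γ] [IsOrderedAddMonoid Γ]
  {K : Type*} [Field K]

theorem coeff_mul_of_support_subset {s : Set Γ} (hs : s.IsPWO) {x y : HahnSeries Γ K}
    (hx : x.support ⊆ s) (hy : y.support ⊆ s) (m : Γ) :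
    (x * y).coeff m = ∑ p ∈ Finset.antidiagonal hs hs m, x.coeff p.1 * y.coeff p.2 := by
  rw [HahnSeries.coeff_mul]
  refine Finset.sum_subset (fun p hp => ?_) fun p hp hp' => ?_
  · rw [Finset.mem_antidiagonal] at hp ⊢
    exact ⟨hx hp.1, hy hp.2.1, hp.2.2⟩
  · rw [Finset.mem_antidiagonal] at hp hp'
    by_contra h
    exact hp' ⟨left_ne_zero_of_mul h, right_ne_zero_of_mul h, hp.2.2⟩

/-- The polynomial over Hahn series whose `m`-th coefficient in `K[X]` is `G m`, truncated to
degrees at most `n`. -/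
noncomputable def ofCoeffs {s : Set Γ} (hs : s.IsPWO) (G : Γ → K[X]) (hG : ∀ m ∉ s, G m = 0)
    (n : ℕ) : (HahnSeries Γ K)[X] :=
  ∑ i ∈ Finset.range (n + 1), monomial i
    { coeff := fun m => (G m).coeff i
      isPWO_support' := hs.mono fun m hm => by
        by_contra h
        exact hm (by simp [hG m h]) }

theorem coeff_coeff_ofCoeffs {s : Set Γ} (hs : s.IsPWO) (G : Γ → K[X]) (hG : ∀ m ∉ s, G m = 0)
    {n : ℕ} (hn : ∀ m, (G m).natDegree ≤ n) (i : ℕ) (m : Γ) :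
    ((ofCoeffs hs G hG n).coeff i).coeff m = (G m).coeff i := by
  simp only [ofCoeffs, finsetSum_coeff, coeff_monomial, Finset.sum_ite_eq', Finset.mem_range]
  split_ifs with h
  · rfl
  · rw [HahnSeries.coeff_zero, coeff_eq_zero_of_natDegree_lt]
    have := hn m
    omega

theorem monic_ofCoeffs {s : Set Γ} (hs : s.IsPWO) {G : Γ → K[X]} (hG : ∀ m ∉ s, G m = 0)
    {a : K[X]} (ha : a.Monic) (h0 : G 0 = a) (hlt : ∀ m ≠ 0, (G m).degree < a.degree) :
    (ofCoeffs hs G hG a.natDegree).Monic ∧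
      (ofCoeffs hs G hG a.natDegree).natDegree = a.natDegree := by
  have hn : ∀ m, (G m).natDegree ≤ a.natDegree := fun m => by
    by_cases hm : m = 0
    · rw [hm, h0]
    · exact natDegree_le_natDegree (hlt m hm).le
  have hle : (ofCoeffs hs G hG a.natDegree).natDegree ≤ a.natDegree := by
    refine natDegree_le_iff_coeff_eq_zero.2 fun N hN => ?_
    ext m
    rw [coeff_coeff_ofCoeffs hs G hG hn, coeff_eq_zero_of_natDegree_lt ((hn m).trans_lt hN),
      HahnSeries.coeff_zero]
  have h1 : (ofCoeffs hs G hG a.natDegree).coeff a.natDegree = 1 := by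
    ext m
    rw [coeff_coeff_ofCoeffs hs G hG hn, HahnSeries.coeff_one]
    split_ifs with hm
    · rw [hm, h0, ha.coeff_natDegree]
    · exact coeff_eq_zero_of_degree_lt ((hlt m hm).trans_eq (degree_eq_natDegree ha.ne_zero))
  have hm := monic_of_natDegree_le_of_coeff_eq_one _ hle h1
  exact ⟨hm, le_antisymm hle (le_natDegree_of_ne_zero (by simp [h1]))⟩

/-- Hensel's lemma for factorizations of polynomials over Hahn series, with control of the
exponents of the factors. -/
theorem exists_factorization_of_isCoprime {M : AddSubmonoid Γ} (hM : (M : Set Γ).IsPWO)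
    (hpos : ∀ m ∈ M, 0 ≤ m) {f : (HahnSeries Γ K)[X]} (hf : f.Monic)
    (hfM : ∀ i, (f.coeff i).support ⊆ M) {a b : K[X]} (ha : a.Monic) (hb : b.Monic)
    (hab : IsCoprime a b) (hdeg : f.natDegree = a.natDegree + b.natDegree)
    (hred : ∀ i, (f.coeff i).coeff 0 = (a * b).coeff i) :
    ∃ g h : (HahnSeries Γ K)[X], g.Monic ∧ h.Monic ∧ g.natDegree = a.natDegree ∧
      h.natDegree = b.natDegree ∧ f = g * h ∧
      (∀ i, (g.coeff i).support ⊆ M) ∧ ∀ i, (h.coeff i).support ⊆ M := by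
  let F : Γ → K[X] := fun m => ∑ i ∈ Finset.range (f.natDegree + 1),
    monomial i ((f.coeff i).coeff m)
  have hF : ∀ i m, (F m).coeff i = (f.coeff i).coeff m := fun i m => by
    simp only [F, finsetSum_coeff, coeff_monomial, Finset.sum_ite_eq', Finset.mem_range]
    split_ifs with h
    · rfl
    · rw [coeff_eq_zero_of_natDegree_lt (by omega), HahnSeries.coeff_zero]
  have hF0 : F 0 = a * b := by
    ext i
    rw [hF, hred]
  have hFlt : ∀ m ≠ 0, (F m).degree < a.degree + b.degree := fun m hm => by
    rw [degree_eq_natDegree ha.ne_zero, degree_eq_natDegree hb.ne_zero, ← Nat.cast_add, ← hdeg,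
      degree_lt_iff_coeff_zero]
    intro i hi
    rw [hF]
    rcases hi.eq_or_lt with rfl | hi
    · rw [hf.coeff_natDegree, HahnSeries.coeff_one, if_neg hm]
    · rw [coeff_eq_zero_of_natDegree_lt hi, HahnSeries.coeff_zero]
  obtain ⟨G, H, hG0, hH0, hGH, hlt, hsum⟩ := exists_factor_coeffs hM hpos ha hb hab hF0 hFlt
  have hG : ∀ m ∉ (M : Set Γ), G m = 0 := fun m hm => (hGH m hm).1
  have hH : ∀ m ∉ (M : Set Γ), H m = 0 := fun m hm => (hGH m hm).2
  have hGn : ∀ m, (G m).natDegree ≤ a.natDegree := fun m => by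
    by_cases hm : m = 0
    · rw [hm, hG0]
    · exact natDegree_le_natDegree (hlt m hm).1.le
  have hHn : ∀ m, (H m).natDegree ≤ b.natDegree := fun m => by
    by_cases hm : m = 0
    · rw [hm, hH0]
    · exact natDegree_le_natDegree (hlt m hm).2.le
  obtain ⟨hg1, hg2⟩ := monic_ofCoeffs hM hG ha hG0 fun m hm => (hlt m hm).1
  obtain ⟨hh1, hh2⟩ := monic_ofCoeffs hM hH hb hH0 fun m hm => (hlt m hm).2
  have hgM : ∀ i, ((ofCoeffs hM G hG a.natDegree).coeff i).support ⊆ M := fun i m hm => by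
    by_contra h
    exact hm (by rw [coeff_coeff_ofCoeffs hM G hG hGn, hG m h, coeff_zero])
  have hhM : ∀ i, ((ofCoeffs hM H hH b.natDegree).coeff i).support ⊆ M := fun i m hm => by
    by_contra h
    exact hm (by rw [coeff_coeff_ofCoeffs hM H hH hHn, hH m h, coeff_zero])
  refine ⟨_, _, hg1, hh1, hg2, hh2, ?_, hgM, hhM⟩
  ext i m
  have key : (F m).coeff i = ∑ p ∈ Finset.antidiagonal hM hM m, (G p.1 * H p.2).coeff i := by
    rw [← finsetSum_coeff]
    by_cases hm : m ∈ M
    · rw [hsum m hm]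
    · rw [Finset.sum_eq_zero, hF, coeff_zero]
      · by_contra h
        exact hm (hfM i h)
      · intro p hp
        obtain ⟨h1, h2, rfl⟩ := Finset.mem_antidiagonal.1 hp
        exact absurd (M.add_mem h1 h2) hm
  rw [← hF, key, coeff_mul, HahnSeries.coeff_sum]
  simp only [coeff_mul_of_support_subset hM (hgM _) (hhM _), coeff_coeff_ofCoeffs hM G hG hGn,
    coeff_coeff_ofCoeffs hM H hH hHn, coeff_mul]
  exact Finset.sum_comm

/-- A family of sets of exponents for which the Hahn series with exponents in the family form a
field that is closed under extraction of roots. -/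
structure IsSupportFamily [Module ℚ Γ] (Φ : Set Γ → Prop) : Prop where
  mono : ∀ {s t}, s ⊆ t → Φ t → Φ s
  zero : Φ {0}
  union : ∀ {s t}, Φ s → Φ t → Φ (s ∪ t)
  add : ∀ {s t}, Φ s → Φ t → Φ (s + t)
  smul : ∀ {s}, Φ s → ∀ a ∈ s, ∀ q : ℚ, Φ {q • a}
  closure : ∀ {s}, Φ s → (∀ a ∈ s, 0 ≤ a) → Φ (AddSubmonoid.closure s)

/-- Let `m` be the least exponent of `f⁻¹` outside the monoid. In the coefficient of `f * f⁻¹` at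
`m`, which vanishes as `m ≠ 0`, any pair other than `(0, m)` would exhibit `m` as a sum of two
elements of the monoid. Hence the coefficient of `f⁻¹` at `m` is zero, a contradiction. -/
theorem support_inv_subset_closure {f : HahnSeries Γ K} (h1 : f.coeff 0 = 1)
    (hf : ∀ m ∈ f.support, 0 ≤ m) : f⁻¹.support ⊆ AddSubmonoid.closure f.support := by
  have hf0 : f ≠ 0 := by
    rintro rfl
    simp at h1
  by_contra hsub
  rw [Set.not_subset] at hsub
  obtain ⟨m₀, hm₀⟩ := hsub
  set T : Set Γ := {m | m ∈ f⁻¹.support ∧ m ∉ AddSubmonoid.closure f.support}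
  have hT : T.IsWF := f⁻¹.isWF_support.mono fun m hm => hm.1
  have hne : T.Nonempty := ⟨m₀, hm₀⟩
  obtain ⟨hm1, hm2⟩ := hT.min_mem hne
  set m := hT.min hne
  have hmul : (f * f⁻¹).coeff m = 0 := by
    rw [mul_inv_cancel₀ hf0, HahnSeries.coeff_one, if_neg]
    rintro h
    exact hm2 (h ▸ zero_mem _)
  rw [HahnSeries.coeff_mul, Finset.sum_eq_single (0, m)] at hmul
  · rw [h1, one_mul] at hmul
    exact hm1 hmul
  · rintro ⟨x, y⟩ hp hne'
    obtain ⟨hx, hy, hxy⟩ := Finset.mem_antidiagonal.1 hp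
    simp only at hx hy hxy
    have hx0 : x ≠ 0 := by
      rintro rfl
      exact hne' (by rw [← hxy, zero_add])
    have hylt : y < m := by
      rw [← hxy]
      exact lt_add_of_pos_left _ (lt_of_le_of_ne (hf x hx) hx0.symm)
    have hyc : y ∈ AddSubmonoid.closure f.support := by
      by_contra hyc
      exact hT.not_lt_min hne (show y ∈ T from ⟨hy, hyc⟩) hylt
    exact absurd (hxy ▸ add_mem (AddSubmonoid.subset_closure hx) hyc) hm2
  · intro h
    rw [Finset.mem_antidiagonal] at h
    exact absurd ⟨by simp [h1], hm1, zero_add _⟩ h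

namespace IsSupportFamily

variable [Module ℚ Γ] {Φ : Set Γ → Prop}

omit [IsOrderedAddMonoid Γ] in
theorem single (hΦ : IsSupportFamily Φ) {s : Set Γ} (hs : Φ s) {a : Γ} (ha : a ∈ s) (q : ℚ)
    (c : K) : Φ (HahnSeries.single (q • a) c).support :=
  hΦ.mono HahnSeries.support_single_subset (hΦ.smul hs a ha q)

theorem mul (hΦ : IsSupportFamily Φ) {f g : HahnSeries Γ K} (hf : Φ f.support)
    (hg : Φ g.support) : Φ (f * g).support :=
  hΦ.mono HahnSeries.support_mul_subset (hΦ.add hf hg)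

theorem inv (hΦ : IsSupportFamily Φ) {f : HahnSeries Γ K} (hf : Φ f.support) :
    Φ f⁻¹.support := by
  by_cases hf0 : f = 0
  · simpa [hf0] using hf
  have ho : f.order ∈ f.support := by simpa [HahnSeries.coeff_order_eq_zero] using hf0
  set c := f.coeff f.order
  have hc : c ≠ 0 := ho
  -- Multiplying by the inverse of the leading term gives constant term `1` and nonnegative
  -- exponents, as the closure axiom requires.
  set e : HahnSeries Γ K := HahnSeries.single (-f.order) c⁻¹
  have he : Φ e.support := by simpa using hΦ.single hf ho (-1) c⁻¹
  have he0 : e ≠ 0 := by simpa [e] using hc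
  have h1 : (e * f).coeff 0 = 1 := by
    simp [e, HahnSeries.coeff_single_mul, c, inv_mul_cancel₀ hc]
  have hpos : ∀ m ∈ (e * f).support, 0 ≤ m := fun m hm => by
    by_contra! h
    refine hm ?_
    rw [HahnSeries.coeff_single_mul, HahnSeries.coeff_eq_zero_of_lt_order, mul_zero]
    simpa using h
  have h2 : f⁻¹ = e * (e * f)⁻¹ := by
    field_simp
  rw [h2]
  exact hΦ.mul he (hΦ.mono (support_inv_subset_closure h1 hpos)
    (hΦ.closure (hΦ.mul he hf) hpos))

/-- The subfield of Hahn series with exponents in a given family. -/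
def subfield (hΦ : IsSupportFamily Φ) (K : Type*) [Field K] : Subfield (HahnSeries Γ K) where
  carrier := {f | Φ f.support}
  mul_mem' := hΦ.mul
  one_mem' := hΦ.mono HahnSeries.support_single_subset hΦ.zero
  add_mem' hf hg := hΦ.mono (HahnSeries.support_add_subset _ _) (hΦ.union hf hg)
  zero_mem' := hΦ.mono (by simp) hΦ.zero
  neg_mem' hf := by simpa [HahnSeries.support_neg] using hf
  inv_mem' _ hf := hΦ.inv hf

end IsSupportFamily

end

/-! ### Existence of roots by induction on the degree. -/

section

/-- Split off the full power of one root `c`. If nothing remained, `f` would be `(X - C c) ^ (k +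
1)`, whose next coefficient `-(k + 1) * c` vanishes only for `c = 0`; then `f` would have no nonzero
lower coefficient. -/
theorem exists_coprime_factorization_of_depressed {K : Type*} [Field K] [CharZero K]
    [IsAlgClosed K] {f : K[X]} (hf : f.Monic) {k : ℕ} (hk : f.natDegree = k + 1)
    (hfk : f.coeff k = 0) {i : ℕ} (hi : i ≤ k) (hfi : f.coeff i ≠ 0) :
    ∃ a b : K[X], a.Monic ∧ b.Monic ∧ IsCoprime a b ∧ f = a * b ∧ 0 < a.natDegree ∧
      0 < b.natDegree := by
  obtain ⟨c, hc⟩ := IsAlgClosed.exists_root f (by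
    rw [degree_eq_natDegree hf.ne_zero, hk]
    exact_mod_cast Nat.succ_ne_zero k)
  obtain ⟨b, hb, hnd⟩ := exists_eq_pow_rootMultiplicity_mul_and_not_dvd f hf.ne_zero c
  have hm : 0 < f.rootMultiplicity c := (rootMultiplicity_pos hf.ne_zero).2 hc
  set m := f.rootMultiplicity c
  have ha : ((X - C c) ^ m).Monic := (monic_X_sub_C c).pow m
  have hbm : b.Monic := ha.of_mul_monic_left (hb ▸ hf)
  refine ⟨(X - C c) ^ m, b, ha, hbm, ?_, hb, ?_, Nat.pos_of_ne_zero fun h0 => ?_⟩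
  · exact IsCoprime.pow_left (((irreducible_X_sub_C c).coprime_iff_not_dvd).2 hnd)
  · simpa [natDegree_pow] using hm
  · rw [hbm.natDegree_eq_zero.1 h0, mul_one] at hb
    have hmk : m = k + 1 := by
      rw [← hk, hb, natDegree_pow, natDegree_X_sub_C, mul_one]
    have h1 : f.nextCoeff = 0 := by
      rw [nextCoeff_of_natDegree_pos (by omega), hk, Nat.add_sub_cancel, hfk]
    rw [hb, (monic_X_sub_C c).nextCoeff_pow, nextCoeff_X_sub_C, smul_neg, neg_eq_zero,
      smul_eq_zero, or_iff_right hm.ne'] at h1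
    rw [hb, h1, C_0, sub_zero, coeff_X_pow, if_neg (by omega)] at hfi
    exact hfi rfl

/-- The `k`-th Hasse derivative is linear with leading coefficient `k + 1`. Over a field of
characteristic zero a suitable `r` therefore makes this coefficient vanish. -/
theorem coeff_taylor_of_natDegree_eq_succ {R : Type*} [CommRing R] {f : R[X]} (hf : f.Monic)
    {k : ℕ} (hk : f.natDegree = k + 1) (r : R) :
    (taylor r f).coeff k = f.coeff k + (k + 1) * r := by
  have h : (hasseDeriv k f).natDegree ≤ 1 := (natDegree_hasseDeriv_le f k).trans (by omega)
  have h1 : f.coeff (k + 1) = 1 := by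
    rw [← hk, hf.coeff_natDegree]
  rw [taylor_coeff, eq_X_add_C_of_natDegree_le_one h]
  simp [hasseDeriv_coeff, add_comm 1 k, h1, add_comm]

variable {Γ : Type*} [AddCommGroup Γ] [LinearOrder Γ] [IsOrderedAddMonoid Γ]
  {K : Type*} [Field K]

namespace IsSupportFamily

variable [Module ℚ Γ] {Φ : Set Γ → Prop}

omit [IsOrderedAddMonoid Γ] in
theorem exists_support_bound (hΦ : IsSupportFamily Φ) {ι : Type*} (I : Finset ι)
    {x : ι → HahnSeries Γ K} (hx : ∀ i, Φ (x i).support) (hpos : ∀ i, ∀ m ∈ (x i).support, 0 ≤ m) :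
    ∃ s : Set Γ, s.IsPWO ∧ Φ s ∧ (∀ m ∈ s, 0 ≤ m) ∧ ∀ i ∈ I, (x i).support ⊆ s := by
  classical
  induction I using Finset.induction_on with
  | empty => exact ⟨{0}, Set.isPWO_singleton 0, hΦ.zero, by simp, by simp⟩
  | insert j I _ ih =>
    obtain ⟨s, h1, h2, h3, h4⟩ := ih
    refine ⟨(x j).support ∪ s, (x j).isPWO_support.union h1, hΦ.union (hx j) h2, ?_, ?_⟩
    · rintro m (hm | hm)
      exacts [hpos j m hm, h3 m hm]
    · intro i hi
      rcases Finset.mem_insert.1 hi with rfl | hi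
      exacts [Set.subset_union_left, (h4 i hi).trans Set.subset_union_right]

theorem exists_factorization (hΦ : IsSupportFamily Φ) {f : (hΦ.subfield K)[X]} (hf : f.Monic)
    (hpos : ∀ i, ∀ m ∈ (f.coeff i : HahnSeries Γ K).support, 0 ≤ m) {a b : K[X]} (ha : a.Monic)
    (hb : b.Monic) (hab : IsCoprime a b) (hdeg : f.natDegree = a.natDegree + b.natDegree)
    (hred : ∀ i, (f.coeff i : HahnSeries Γ K).coeff 0 = (a * b).coeff i) :
    ∃ g h : (hΦ.subfield K)[X], g.Monic ∧ g.natDegree = a.natDegree ∧ f = g * h := by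
  set ι := (hΦ.subfield K).subtype
  obtain ⟨s, hs, hΦs, hs0, hsub⟩ := hΦ.exists_support_bound (Finset.range (f.natDegree + 1))
    (x := fun i => (f.coeff i : HahnSeries Γ K)) (fun i => (f.coeff i).2) hpos
  have hfM : ∀ i, ((f.map ι).coeff i).support ⊆ AddSubmonoid.closure s := fun i => by
    rw [coeff_map]
    by_cases hi : i < f.natDegree + 1
    · exact (hsub i (Finset.mem_range.2 hi)).trans AddSubmonoid.subset_closure
    · rw [coeff_eq_zero_of_natDegree_lt (by omega), map_zero, HahnSeries.support_zero]
      exact Set.empty_subset _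
  have hM0 : ∀ m ∈ AddSubmonoid.closure s, 0 ≤ m := fun m hm => by
    induction hm using AddSubmonoid.closure_induction with
    | mem x hx => exact hs0 x hx
    | zero => exact le_rfl
    | add x y _ _ hx hy => exact add_nonneg hx hy
  -- A monoid generated by a well-ordered set of nonnegative elements is itself well-ordered, so
  -- Hensel's lemma applies to it.
  obtain ⟨g, h, hg, -, hgd, -, hfgh, hgM, hhM⟩ := exists_factorization_of_isCoprime
    (hs.addSubmonoid_closure hs0) hM0 (hf.map ι) hfM ha hb hab
    (by rw [hf.natDegree_map, hdeg]) (fun i => by rw [coeff_map]; exact hred i)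
  have hlift : ∀ p : (HahnSeries Γ K)[X], (∀ i, (p.coeff i).support ⊆ AddSubmonoid.closure s) →
      p ∈ lifts ι := fun p hp => by
    rw [lifts_iff_coeff_lifts]
    exact fun i => ⟨⟨p.coeff i, hΦ.mono (hp i) (hΦ.closure hΦs hs0)⟩, rfl⟩
  obtain ⟨g', hg', hgd', hgm'⟩ := lifts_and_natDegree_eq_and_monic (hlift g hgM) hg
  obtain ⟨h', hh'⟩ := (mem_lifts _).1 (hlift h hhM)
  refine ⟨g', h', hgm', hgd'.trans hgd, map_injective ι ι.injective ?_⟩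
  rw [Polynomial.map_mul, hg', hh', hfgh]

variable [CharZero K] [IsAlgClosed K]

theorem exists_root_of_depressed (hΦ : IsSupportFamily Φ) {q : (hΦ.subfield K)[X]} (hq : q.Monic)
    {k : ℕ} (hk : q.natDegree = k + 1) (hqk : q.coeff k = 0)
    (ih : ∀ g : (hΦ.subfield K)[X], g.Monic → 0 < g.natDegree → g.natDegree < k + 1 →
      ∃ x, g.eval x = 0) : ∃ x, q.eval x = 0 := by
  classical
  by_cases h0 : q.coeff 0 = 0
  · exact ⟨0, by rwa [← coeff_zero_eq_eval_zero]⟩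
  -- The least `w i` is the slope `v` of the Newton polygon. Replacing the roots `y` by `x ^ (-v) *
  -- y` shifts the exponents of coefficient `i` by `-(k + 1 - i) • v`: all become nonnegative, and
  -- the coefficient at the minimiser `j` acquires a nonzero constant term.
  set w : ℕ → Γ := fun i => ((1 : ℚ) / (k + 1 - i : ℕ)) • (q.coeff i : HahnSeries Γ K).order
  obtain ⟨j, hj, hmin⟩ := Finset.exists_min_image
    ((Finset.range (k + 1)).filter fun i => q.coeff i ≠ 0) w ⟨0, by simpa using h0⟩
  rw [Finset.mem_filter, Finset.mem_range] at hj
  obtain ⟨hjk, hj0⟩ := hj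
  set v := w j
  have hj0' : (q.coeff j : HahnSeries Γ K) ≠ 0 := by simpa using hj0
  have hmem : (q.coeff j : HahnSeries Γ K).order ∈ (q.coeff j : HahnSeries Γ K).support := by
    simpa [HahnSeries.coeff_order_eq_zero] using hj0
  have hsmul : ∀ i < k + 1, (k + 1 - i) • w i = (q.coeff i : HahnSeries Γ K).order :=
    fun i hi => by
      have : ((k + 1 - i : ℕ) : ℚ) ≠ 0 := by
        rw [Nat.cast_ne_zero]
        omega
      rw [← Nat.cast_smul_eq_nsmul ℚ, smul_smul, mul_one_div_cancel this, one_smul]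
  -- The exponent `-v` is a rational multiple of an exponent of `q.coeff j`; this is where the axiom
  -- `smul` needs rational scalars.
  have ht : HahnSeries.single (-v) (1 : K) ∈ hΦ.subfield K := by
    have := hΦ.single (q.coeff j).2 hmem (-((1 : ℚ) / (k + 1 - j : ℕ))) (1 : K)
    rwa [neg_smul] at this
  set t : hΦ.subfield K := ⟨HahnSeries.single (-v) 1, ht⟩
  have ht0 : t ≠ 0 := fun h => by
    have : HahnSeries.single (-v) (1 : K) = 0 := congrArg Subtype.val h
    simp at this
  set Q := q.scaleRoots t
  have hQm : Q.Monic := (monic_scaleRoots_iff t).2 hq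
  have hQd : Q.natDegree = k + 1 := (natDegree_scaleRoots q t).trans hk
  have hQc : ∀ i m, (Q.coeff i : HahnSeries Γ K).coeff m =
      (q.coeff i : HahnSeries Γ K).coeff (m + (k + 1 - i) • v) := fun i m => by
    rw [coeff_scaleRoots, hk]
    simp [t, HahnSeries.single_pow, HahnSeries.coeff_mul_single]
  have hQpos : ∀ i, ∀ m ∈ (Q.coeff i : HahnSeries Γ K).support, 0 ≤ m := fun i m hm => by
    rw [HahnSeries.mem_support, hQc] at hm
    rcases lt_trichotomy i (k + 1) with hi | rfl | hi
    · have hi0 : q.coeff i ≠ 0 := fun h => hm (by simp [h])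
      have h1 := HahnSeries.order_le_of_coeff_ne_zero hm
      have h2 := hmin i (by simp [hi, hi0])
      rw [← hsmul i hi] at h1
      have h3 := nsmul_le_nsmul_right h2 (k + 1 - i)
      simpa using h3.trans h1
    · rw [← hk, hq.coeff_natDegree] at hm
      simp only [hk, Nat.sub_self, zero_smul, add_zero, OneMemClass.coe_one,
        HahnSeries.coeff_one] at hm
      by_contra! h
      exact hm (if_neg h.ne)
    · exact absurd (by rw [coeff_eq_zero_of_natDegree_lt (by omega)]; rfl) hm
  set f : K[X] := ∑ i ∈ Finset.range (k + 2), monomial i ((Q.coeff i : HahnSeries Γ K).coeff 0)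
  have hf : ∀ i, f.coeff i = (Q.coeff i : HahnSeries Γ K).coeff 0 := fun i => by
    simp only [f, finsetSum_coeff, coeff_monomial, Finset.sum_ite_eq', Finset.mem_range]
    split_ifs with h
    · rfl
    · rw [coeff_eq_zero_of_natDegree_lt (by omega)]
      rfl
  have hf1 : f.coeff (k + 1) = 1 := by
    rw [hf, ← hQd, hQm.coeff_natDegree]
    simp
  have hfle : f.natDegree ≤ k + 1 := natDegree_le_iff_coeff_eq_zero.2 fun N hN => by
    rw [hf, coeff_eq_zero_of_natDegree_lt (by omega)]
    rfl
  have hfm : f.Monic := monic_of_natDegree_le_of_coeff_eq_one _ hfle hf1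
  have hfd : f.natDegree = k + 1 := le_antisymm hfle (le_natDegree_of_ne_zero (by simp [hf1]))
  have hfk : f.coeff k = 0 := by
    rw [hf, hQc, hqk]
    rfl
  have hfj : f.coeff j ≠ 0 := by
    rw [hf, hQc, zero_add, hsmul j hjk]
    exact hmem
  obtain ⟨a, b, ha, hb, hab, hfab, ha0, hb0⟩ :=
    exists_coprime_factorization_of_depressed hfm hfd hfk (Nat.lt_succ_iff.1 hjk) hfj
  have hd : a.natDegree + b.natDegree = k + 1 := by
    rw [← ha.natDegree_mul hb, ← hfab, hfd]
  obtain ⟨g, h, hg, hgd, hQgh⟩ := hΦ.exists_factorization hQm hQpos ha hb hab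
    (hQd.trans hd.symm) fun i => by rw [← hf, hfab]
  obtain ⟨x, hx⟩ := ih g hg (by omega) (by omega)
  refine ⟨t⁻¹ * x, ?_⟩
  have h1 : Q.eval (t * (t⁻¹ * x)) = 0 := by
    rw [mul_inv_cancel_left₀ ht0, hQgh, eval_mul, hx, zero_mul]
  rw [scaleRoots_eval_mul] at h1
  exact (mul_eq_zero.1 h1).resolve_left (pow_ne_zero _ ht0)

theorem exists_root (hΦ : IsSupportFamily Φ) (n : ℕ) (p : (hΦ.subfield K)[X]) (hp : p.Monic)
    (hn : p.natDegree = n) (hn0 : 0 < n) : ∃ x, p.eval x = 0 := by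
  induction n using Nat.strong_induction_on generalizing p with
  | _ n ih =>
    obtain ⟨k, rfl⟩ : ∃ k, n = k + 1 := ⟨n - 1, by omega⟩
    have : CharZero (HahnSeries Γ K) :=
      charZero_of_injective_ringHom (HahnSeries.C_injective (Γ := Γ) (R := K))
    have : CharZero (hΦ.subfield K) := (hΦ.subfield K).subtype.charZero
    have hk0 : ((k : hΦ.subfield K) + 1) ≠ 0 := Nat.cast_add_one_ne_zero k
    set r := -(p.coeff k) / ((k : hΦ.subfield K) + 1)
    obtain ⟨x, hx⟩ := hΦ.exists_root_of_depressed (q := taylor r p) (k := k)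
      (by rw [Monic, leadingCoeff_taylor]; exact hp) (by rw [natDegree_taylor, hn])
      (by rw [coeff_taylor_of_natDegree_eq_succ hp hn, mul_div_cancel₀ _ hk0, add_neg_cancel])
      (fun g hg hg0 hgk => ih _ hgk g hg rfl hg0)
    exact ⟨x + r, by rwa [taylor_eval] at hx⟩

theorem isAlgClosed_subfield (hΦ : IsSupportFamily Φ) : IsAlgClosed (hΦ.subfield K) :=
  IsAlgClosed.of_exists_root _ fun p hp hirr => hΦ.exists_root _ p hp rfl hirr.natDegree_pos

end IsSupportFamily

end

/-! ### The concrete support conditions. -/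

section

/-- An infinite set with finitely many elements below each bound is countable, and every injective
enumeration of it diverges to infinity. -/
theorem levelZero_iff {s : Set ℝ} : LevelZero s ↔ ∀ b, (s ∩ Set.Iic b).Finite := by
  constructor
  · rintro (h | ⟨u, hu, rfl⟩) b
    · exact h.inter_of_left _
    · have h1 : {n | u n ≤ b}.Finite := by
        obtain ⟨N, hN⟩ := Filter.eventually_atTop.1 (hu.eventually_gt_atTop b)
        exact (Set.finite_lt_nat N).subset fun n hn => not_le.1 fun h => (hN n h).not_ge hn
      refine (h1.image u).subset ?_
      rintro _ ⟨⟨n, rfl⟩, hn⟩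
      exact ⟨n, hn, rfl⟩
  · intro h
    by_cases hs : s.Finite
    · exact Or.inl hs
    refine Or.inr ?_
    have hc : s.Countable := by
      have : s = ⋃ n : ℕ, s ∩ Set.Iic (n : ℝ) := by
        ext x
        simpa using fun _ => exists_nat_ge x
      rw [this]
      exact Set.countable_iUnion fun n => (h n).countable
    have := hc.to_subtype
    have : Infinite s := Set.infinite_coe_iff.2 hs
    obtain ⟨e⟩ := nonempty_equiv_of_countable (α := ℕ) (β := s)
    refine ⟨fun n => e n, ?_, ?_⟩
    · refine Filter.tendsto_atTop.2 fun b => ?_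
      rw [← Nat.cofinite_eq_atTop, Filter.eventually_cofinite]
      refine Set.Finite.of_finite_image ((h b).subset ?_)
        (Subtype.val_injective.comp e.injective).injOn
      rintro _ ⟨n, hn, rfl⟩
      exact ⟨(e n).2, (not_le.1 hn).le⟩
    · rw [Set.range_comp' Subtype.val e, e.surjective.range_eq, Set.image_univ,
        Subtype.range_coe]

/-- Left-finite sets of exponents in a subspace of `ℝ`. -/
def LeftFinite {R : Submodule ℚ ℝ} (s : Set R) : Prop :=
  ∀ b : ℝ, {r ∈ s | (r : ℝ) ≤ b}.Finite

variable {R : Submodule ℚ ℝ}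

theorem levelZero_image_iff {s : Set R} :
    LevelZero ((fun r : R => (r : ℝ)) '' s) ↔ LeftFinite s := by
  rw [levelZero_iff]
  refine forall_congr' fun b => ?_
  rw [← Set.finite_image_iff (f := fun r : R => (r : ℝ)) Subtype.val_injective.injOn]
  congr! 1
  ext x
  simp only [Set.mem_inter_iff, Set.mem_image, Set.mem_Iic, Set.mem_ofPred_eq]
  constructor
  · rintro ⟨⟨r, hr, rfl⟩, hb⟩
    exact ⟨r, ⟨hr, hb⟩, rfl⟩
  · rintro ⟨r, ⟨hr, hb⟩, rfl⟩
    exact ⟨⟨r, hr, rfl⟩, hb⟩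

theorem LeftFinite.exists_lower_bound {s : Set R} (hs : LeftFinite s) :
    ∃ c : ℝ, ∀ r ∈ s, c ≤ r := by
  obtain ⟨c, hc⟩ := ((hs 0).image fun r : R => (r : ℝ)).bddBelow
  refine ⟨min c 0, fun r hr => ?_⟩
  rcases le_total (r : ℝ) 0 with h | h
  · exact (min_le_left _ _).trans (hc ⟨r, ⟨hr, h⟩, rfl⟩)
  · exact (min_le_right _ _).trans h

theorem LeftFinite.add {s t : Set R} (hs : LeftFinite s) (ht : LeftFinite t) :
    LeftFinite (s + t) := by
  obtain ⟨c, hc⟩ := hs.exists_lower_bound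
  obtain ⟨d, hd⟩ := ht.exists_lower_bound
  intro b
  refine ((hs (b - d)).add (ht (b - c))).subset ?_
  rintro _ ⟨⟨x, hx, y, hy, rfl⟩, hb⟩
  have h1 := hc x hx
  have h2 := hd y hy
  simp only [Submodule.coe_add] at hb
  exact ⟨x, ⟨hx, by linarith⟩, y, ⟨hy, by linarith⟩, rfl⟩

/-- Left-finiteness gives a gap `δ` below all nonzero generators. Removing one nonzero generator
from a sum lowers it by at least `δ`, so induction on `n` shows that finitely many sums are at most
`n * δ`. -/
theorem LeftFinite.closure {s : Set R} (hs : LeftFinite s) (hpos : ∀ a ∈ s, 0 ≤ a) :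
    LeftFinite (AddSubmonoid.closure s : Set R) := by
  obtain ⟨δ, hδ, hδs⟩ : ∃ δ : ℝ, 0 < δ ∧ ∀ a ∈ s, a ≠ 0 → δ ≤ a := by
    by_cases hne : {a ∈ s | (a : ℝ) ≤ 1 ∧ a ≠ 0}.Nonempty
    · obtain ⟨m, hm, hmin⟩ := Set.exists_min_image _ (fun a : R => (a : ℝ))
        ((hs 1).subset fun a ha => ⟨ha.1, ha.2.1⟩) hne
      refine ⟨m, lt_of_le_of_ne (hpos m hm.1) fun h => hm.2.2 (Subtype.ext h.symm),
        fun a ha ha0 => ?_⟩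
      rcases le_total (a : ℝ) 1 with h | h
      · exact hmin a ⟨ha, h, ha0⟩
      · exact hm.2.1.trans h
    · refine ⟨1, one_pos, fun a ha ha0 => ?_⟩
      by_contra! h
      exact hne ⟨a, ha, h.le, ha0⟩
  have hpos' : ∀ m ∈ AddSubmonoid.closure s, (0 : ℝ) ≤ m := fun m hm => by
    induction hm using AddSubmonoid.closure_induction with
    | mem x hx => exact hpos x hx
    | zero => exact le_rfl
    | add x y _ _ hx hy => simpa using add_nonneg hx hy
  have key : ∀ n : ℕ, {r ∈ (AddSubmonoid.closure s : Set R) | (r : ℝ) ≤ n * δ}.Finite := by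
    intro n
    induction n with
    | zero =>
      refine (Set.finite_singleton 0).subset fun r hr => ?_
      have h1 := hpos' r hr.1
      have h2 := hr.2
      simp only [Nat.cast_zero, zero_mul] at h2
      exact Subtype.ext (le_antisymm h2 h1)
    | succ n ih =>
      refine ((Set.finite_singleton 0).union ((hs ((n + 1 : ℕ) * δ)).add ih)).subset ?_
      rintro r ⟨hr, hrn⟩
      induction hr using AddSubmonoid.closure_induction_left with
      | zero => exact Or.inl rfl
      | add_left x hx y hy ihy =>
        have hx0 : (0 : ℝ) ≤ x := hpos x hx
        have hy0 := hpos' y hy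
        simp only [Submodule.coe_add] at hrn
        by_cases hx' : x = 0
        · subst hx'
          rw [zero_add]
          exact ihy (by simpa using hrn)
        · refine Or.inr ⟨x, ⟨hx, by linarith⟩, y, ⟨hy, ?_⟩, rfl⟩
          have := hδs x hx hx'
          push_cast at hrn
          linarith
  intro b
  obtain ⟨n, hn⟩ := exists_nat_ge (b / δ)
  exact (key n).subset fun r hr => ⟨hr.1, hr.2.trans ((div_le_iff₀ hδ).1 hn)⟩

theorem isSupportFamily_leftFinite : IsSupportFamily (LeftFinite (R := R)) where
  mono hst ht b := (ht b).subset fun _ hr => ⟨hst hr.1, hr.2⟩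
  zero _ := (Set.finite_singleton 0).subset fun _ hr => hr.1
  union hs ht b := ((hs b).union (ht b)).subset fun _ hr =>
    hr.1.imp (fun h => ⟨h, hr.2⟩) fun h => ⟨h, hr.2⟩
  add := LeftFinite.add
  smul _ a _ q _ := (Set.finite_singleton (q • a)).subset fun _ hr => hr.1
  closure := LeftFinite.closure

/-- Support families can be restricted to the exponents in a `ℚ`-subspace. -/
theorem IsSupportFamily.inf_submodule {Γ : Type*} [AddCommGroup Γ] [LinearOrder Γ] [Module ℚ Γ]
    {Φ : Set Γ → Prop} (hΦ : IsSupportFamily Φ) (V : Submodule ℚ Γ) :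
    IsSupportFamily fun s => Φ s ∧ s ⊆ V where
  mono hst ht := ⟨hΦ.mono hst ht.1, hst.trans ht.2⟩
  zero := ⟨hΦ.zero, by simp⟩
  union hs ht := ⟨hΦ.union hs.1 ht.1, Set.union_subset hs.2 ht.2⟩
  add hs ht := ⟨hΦ.add hs.1 ht.1, by
    rintro _ ⟨x, hx, y, hy, rfl⟩
    exact V.add_mem (hs.2 hx) (ht.2 hy)⟩
  smul hs a ha q := ⟨hΦ.smul hs.1 a ha q, by simpa using V.smul_mem q (hs.2 ha)⟩
  closure hs h0 := ⟨hΦ.closure hs.1 h0,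
    (AddSubmonoid.closure_le (S := V.toAddSubmonoid)).2 hs.2⟩

/-- The rational elements of a subspace of `ℝ`. -/
noncomputable def rationalExponents (R : Submodule ℚ ℝ) : Submodule ℚ R :=
  (LinearMap.range (Algebra.linearMap ℚ ℝ)).comap R.subtype

/-- Sets of rational numbers with a common denominator. -/
def HasCommonDenominator (s : Set ℚ) : Prop :=
  ∃ k : ℕ, 0 < k ∧ ∀ q ∈ s, ∃ n : ℤ, q = (n : ℚ) / (k : ℚ)

theorem HasCommonDenominator.sup {s t : Set ℚ} (hs : HasCommonDenominator s)
    (ht : HasCommonDenominator t) : ∃ k : ℕ, 0 < k ∧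
      (∀ q ∈ s, ∃ n : ℤ, q = (n : ℚ) / (k : ℚ)) ∧ ∀ q ∈ t, ∃ n : ℤ, q = (n : ℚ) / (k : ℚ) := by
  obtain ⟨k, hk, hs⟩ := hs
  obtain ⟨l, hl, ht⟩ := ht
  have hk' : (k : ℚ) ≠ 0 := by positivity
  have hl' : (l : ℚ) ≠ 0 := by positivity
  refine ⟨k * l, Nat.mul_pos hk hl, fun q hq => ?_, fun q hq => ?_⟩
  · obtain ⟨n, rfl⟩ := hs q hq
    exact ⟨n * l, by push_cast; field_simp⟩
  · obtain ⟨n, rfl⟩ := ht q hq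
    exact ⟨n * k, by push_cast; field_simp⟩

theorem isSupportFamily_hasCommonDenominator : IsSupportFamily HasCommonDenominator where
  mono hst := fun ⟨k, hk, h⟩ => ⟨k, hk, fun q hq => h q (hst hq)⟩
  zero := ⟨1, one_pos, fun q hq => ⟨0, by simpa using hq⟩⟩
  union hs ht := by
    obtain ⟨k, hk, h1, h2⟩ := hs.sup ht
    exact ⟨k, hk, fun q hq => hq.elim (h1 q) (h2 q)⟩
  add hs ht := by
    obtain ⟨k, hk, h1, h2⟩ := hs.sup ht
    refine ⟨k, hk, ?_⟩
    rintro _ ⟨x, hx, y, hy, rfl⟩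
    obtain ⟨m, rfl⟩ := h1 x hx
    obtain ⟨n, rfl⟩ := h2 y hy
    exact ⟨m + n, by push_cast; ring⟩
  smul _ a _ q := by
    -- A single rational number serves with its own denominator, so the denominator may depend on
    -- `q` and `a`.
    refine ⟨(q * a).den, (q * a).den_pos, ?_⟩
    rintro _ rfl
    exact ⟨(q * a).num, by rw [Rat.num_div_den, smul_eq_mul]⟩
  closure := by
    rintro s ⟨k, hk, h⟩ -
    refine ⟨k, hk, fun q hq => ?_⟩
    induction hq using AddSubmonoid.closure_induction with
    | mem x hx => exact h x hx
    | zero => exact ⟨0, by simp⟩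
    | add x y _ _ hx hy =>
      obtain ⟨m, rfl⟩ := hx
      obtain ⟨n, rfl⟩ := hy
      exact ⟨m + n, by push_cast; ring⟩

end

end GenPuiseux

theorem mainTheorem2 (K : Type*) [Field K] [CharZero K] [IsAlgClosed K]
    (R : Submodule ℚ ℝ) :
    (∃ F : Subfield (GenPuiseux.PuiseuxField R K),
      (F : Set (GenPuiseux.PuiseuxField R K)) = GenPuiseux.levelZeroSeries R K ∧
        IsAlgClosed F) ∧
    (∃ F : Subfield (GenPuiseux.PuiseuxField R K),
      (F : Set (GenPuiseux.PuiseuxField R K)) = GenPuiseux.rationalLevelZeroSeries R K ∧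
        IsAlgClosed F) ∧
    (∃ F : Subfield (HahnSeries ℚ K),
      (F : Set (HahnSeries ℚ K)) = GenPuiseux.classicalPuiseuxSeries K ∧
        IsAlgClosed F) := by
  have h1 := GenPuiseux.isSupportFamily_leftFinite (R := R)
  have h2 := h1.inf_submodule (GenPuiseux.rationalExponents R)
  have h3 := GenPuiseux.isSupportFamily_hasCommonDenominator
  refine ⟨⟨h1.subfield K, ?_, h1.isAlgClosed_subfield⟩,
    ⟨h2.subfield K, ?_, h2.isAlgClosed_subfield⟩, ⟨h3.subfield K, rfl, h3.isAlgClosed_subfield⟩⟩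
  · ext f
    exact GenPuiseux.levelZero_image_iff.symm
  · ext f
    refine and_congr GenPuiseux.levelZero_image_iff.symm ?_
    rw [GenPuiseux.exponents, Set.image_subset_iff]
    rfl
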